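/- **Definitions.** A Büchi automaton over a finite alphabet $\Sigma$ has a finite set of states, an initial state, a transition table $\Delta\subseteq S\times\Sigma\times S$ and a set of accepting states; it accepts an infinite string $\alpha\in\Sigma^\omega$ if some run on $\alpha$ visits some accepting state infinitely often. A set of infinite strings is Büchi recognizable if it is the set of strings accepted by some Büchi automaton. A $k$-ary relation on $\Sigma^\omega$ is Büchi recognizable if the set of convolutions of its tuples (as infinite strings over $\Sigma^k$) is. A relational structure with nonempty domain $A\subseteq\Sigma^\omega$ is Büchi automatic if its domain and its basic relations are Büchi recognizable, and it is Borel if they are Borel; a structure is Büchi (Borel) presentable if it is isomorphic to a Büchi automatic (Borel) structure over some finite alphabet. The quotient $\mathcal A/E$ of a relational structure by an equivalence relation $E$ on its domain has the $E$-classes as elements, and a basic relation holds of a tuple of classes if it holds of some tuple of representatives. For $X,Y\subseteq\mathbb N$, $X=^*Y$ means that $X\,\triangle\,Y$ is finite, and $[X]\le[Y]$ in $\mathcal P(\mathbb N)/{=^*}$ means that $X\setminus Y$ is finite. **Theorem** (Hjorth, Khoussainov, Montalbán, Nies; 2008). The class of Büchi automatic structures is not closed, even up to isomorphism, under quotients by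 Büchi recognizable equivalence relations. More precisely: 1. There are a Büchi automatic structure $\mathcal A=(A;\le,U,R)$ and a Büchi recognizable equivalence relation $E$ on $A$ such that - $\mathcal A$ is isomorphic to the disjoint union of two copies $\mathcal P(\mathbb N)\times\{0\}$ and $\mathcal P(\mathbb N)\times\{1\}$ of $(\mathcal P(\mathbb N);\subseteq)$, with the unary relation $U$ that holds exactly on the first copy and the binary relation $R=\{((X,0),(X,1)) : X\subseteq\mathbb N\}$, by an isomorphism that carries $E$ to the relation which is equality on the first copy, $=^*$ on the second copy, and relates no element of one copy to an element of the other; - $\mathcal A/E$ is isomorphic to the disjoint union of $(\mathcal P(\mathbb N);\subseteq)$ and $(\mathcal P(\mathbb N)/{=^*};\le)$, with $U$ holding exactly on $\mathcal P(\mathbb N)$ and $R$ being the graph of the canonical projection $\mathcal P(\mathbb N)\to\mathcal P(\mathbb N)/{=^*}$; - $\mathcal A/E$ is not Büchi presentable, and it is not even Borel presentable. 2. The equivalence relation can also be taken to be a congruence: there are a Büchi automatic structure $\mathcal A=(A;\le,U,R)$ and a Büchi recognizable equivalence relation $E$ on $A$ under which every basic relation of $\mathcal A$ is invariant, such that $\mathcal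 A/E$ is isomorphic to the same disjoint union as in 1 and is neither Büchi presentable nor Borel presentable. -/

import Mathlib

open FirstOrder Filter

/-! ### Büchi automata -/

/-- A Büchi automaton over the alphabet `α` with set of states `σ`: an initial state, a transition
table and a set of accepting states. Finiteness of `α` and `σ` is required where automata are used. -/
structure BuchiAutomaton (α σ : Type) where
  init : σ
  trans : Set (σ × α × σ)
  accept : Set σ

namespace BuchiAutomaton

variable {α σ : Type}

/-- `q` is a run of `M` on the infinite string `w`. -/
def IsRun (M : BuchiAutomaton α σ) (w : ℕ → α) (q : ℕ → σ) : Prop :=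
  q 0 = M.init ∧ ∀ i, (q i, w i, q (i + 1)) ∈ M.trans

/-- `M` accepts `w` if on some run of `M` on `w` some accepting state appears infinitely often. -/
def Accepts (M : BuchiAutomaton α σ) (w : ℕ → α) : Prop :=
  ∃ q, M.IsRun w q ∧ ∃ s ∈ M.accept, ∃ᶠ i in atTop, q i = s

/-- The set of infinite strings that `M` accepts. -/
def acceptedSet (M : BuchiAutomaton α σ) : Set (ℕ → α) := {w | M.Accepts w}

end BuchiAutomaton

/-- A set of infinite strings is Büchi recognizable if it is the language of a Büchi automaton with
finitely many states. -/
def IsBuchiRecognizable {α : Type} (W : Set (ℕ → α)) : Prop :=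
  ∃ (σ : Type) (_ : Finite σ) (M : BuchiAutomaton α σ), M.acceptedSet = W

/-- The convolution of a `k`-tuple of infinite strings over `α`, an infinite string over `α ^ k`. -/
def convolution {α : Type} {k : ℕ} (x : Fin k → ℕ → α) : ℕ → (Fin k → α) := fun i j => x j i

/-- A `k`-ary relation on infinite strings is Büchi recognizable if the set of the convolutions of
its tuples is. -/
def IsBuchiRecognizableRel {α : Type} {k : ℕ} (R : Set (Fin k → ℕ → α)) : Prop :=
  IsBuchiRecognizable (convolution '' R)

/-! ### Structures on sets of infinite strings -/

/-- The interpretation of a relation symbol in a structure with domain `D ⊆ X`, as a set of tuples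
of elements of `X`. -/
def relSet (L : Language) {X : Type} (D : Set X) [L.Structure D] {n : ℕ} (r : L.Relations n) :
    Set (Fin n → X) :=
  (fun (y : Fin n → D) i => (y i : X)) '' {y | Language.Structure.RelMap r y}

/-- A binary relation on `D ⊆ X`, as a set of pairs of elements of `X`. -/
def pairSet {X : Type} (D : Set X) (E : D → D → Prop) : Set (Fin 2 → X) :=
  {x | ∃ a b : D, E a b ∧ x = ![(a : X), (b : X)]}

/-- A structure (with nonempty domain, in a relational language) whose elements are infinite strings
is Büchi automatic if its domain and its basic relations are Büchi recognizable. -/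
structure IsBuchiAutomatic (L : Language) [L.IsRelational] {α : Type} (D : Set (ℕ → α))
    [L.Structure D] : Prop where
  nonempty : D.Nonempty
  domain : IsBuchiRecognizable D
  relations : ∀ {n : ℕ} (r : L.Relations n), IsBuchiRecognizableRel (relSet L D r)

/-- A structure is Büchi automata presentable if it is isomorphic to a Büchi automatic structure
over some finite alphabet. -/
def IsBuchiPresentable (L : Language) [L.IsRelational] (M : Type) [L.Structure M] : Prop :=
  ∃ (α : Type) (_ : Finite α) (D : Set (ℕ → α)) (_ : L.Structure D),
    IsBuchiAutomatic L D ∧ Nonempty (M ≃[L] D)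

/-- A set of `k`-tuples of infinite strings over `α` is Borel for the product topology, where `α` is
discrete. -/
def IsBorelStringRel {α : Type} {k : ℕ} (R : Set (Fin k → ℕ → α)) : Prop :=
  letI : TopologicalSpace α := ⊥
  @MeasurableSet (Fin k → ℕ → α) (borel (Fin k → ℕ → α)) R

/-- A set of infinite strings over `α` is Borel for the product topology, where `α` is discrete. -/
def IsBorelStringSet {α : Type} (W : Set (ℕ → α)) : Prop :=
  letI : TopologicalSpace α := ⊥
  @MeasurableSet (ℕ → α) (borel (ℕ → α)) W

/-- A structure (with nonempty domain, in a relational language) whose elements are infinite strings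
is Borel if its domain and its basic relations are Borel. -/
structure IsBorelStructure (L : Language) [L.IsRelational] {α : Type} (D : Set (ℕ → α))
    [L.Structure D] : Prop where
  nonempty : D.Nonempty
  domain : IsBorelStringSet D
  relations : ∀ {n : ℕ} (r : L.Relations n), IsBorelStringRel (relSet L D r)

/-- A structure is Borel presentable if it is isomorphic to a Borel structure whose elements are
infinite strings over some finite alphabet. -/
def IsBorelPresentable (L : Language) [L.IsRelational] (M : Type) [L.Structure M] : Prop :=
  ∃ (α : Type) (_ : Finite α) (D : Set (ℕ → α)) (_ : L.Structure D),
    IsBorelStructure L D ∧ Nonempty (M ≃[L] D)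

/-! ### Quotient structures -/

/-- The domain of the quotient of the `L`-structure `M` by the equivalence relation `E`. -/
def QuotientStructure (L : Language) {M : Type} [L.Structure M] (E : Setoid M) : Type := Quotient E

/-- A basic relation holds of a tuple of classes if it holds of some tuple of representatives. -/
instance quotientInst (L : Language) [L.IsRelational] {M : Type} [L.Structure M] (E : Setoid M) :
    L.Structure (QuotientStructure L E) where
  funMap f _ := isEmptyElim f
  RelMap r x := ∃ y, (∀ i, (Quotient.mk E (y i) : QuotientStructure L E) = x i) ∧
    Language.Structure.RelMap r y

/-- `E` is a congruence: every basic relation is invariant under `E`. -/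
def IsCongruence (L : Language) {M : Type} [L.Structure M] (E : Setoid M) : Prop :=
  ∀ {n : ℕ} (r : L.Relations n) (x y : Fin n → M), (∀ i, E (x i) (y i)) →
    (Language.Structure.RelMap r x ↔ Language.Structure.RelMap r y)

/-! ### Power sets modulo finite sets -/

/-- `X =^* Y`: the sets `X` and `Y` agree except at finitely many points. -/
def eqStar : Setoid (Set ℕ) where
  r X Y := (symmDiff X Y).Finite
  iseqv :=
    { refl := fun X => by simp
      symm := fun {X Y} h => by rwa [symmDiff_comm]
      trans := fun {X Y Z} h h' => (h.union h').subset (symmDiff_triangle X Y Z) }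

/-- The order that inclusion induces on the classes of `=^*`: `[X] ≤ [Y]` if `X \ Y` is finite. -/
def leStar : Quotient eqStar → Quotient eqStar → Prop :=
  Quotient.lift₂ (fun X Y : Set ℕ => (X \ Y).Finite) (by
    have key : ∀ X Y X' Y' : Set ℕ, (symmDiff X X').Finite → (symmDiff Y Y').Finite →
        (X \ Y).Finite → (X' \ Y').Finite := by
      intro X Y X' Y' hX hY h
      refine ((hX.union hY).union h).subset ?_
      intro n hn
      simp only [Set.mem_union, Set.mem_symmDiff, Set.mem_sdiff] at hn ⊢
      tauto
    intro X Y X' Y' hX hY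
    exact propext ⟨key X Y X' Y' hX hY,
      key X' Y' X Y (eqStar.symm hX) (eqStar.symm hY)⟩)

/-! ### The witness -/

/-- The relation symbols `≤` (binary), `U` (unary) and `R` (binary). -/
inductive WitnessRel : ℕ → Type
  | le : WitnessRel 2
  | U : WitnessRel 1
  | R : WitnessRel 2

/-- The relational language with the symbols `≤`, `U` and `R`. -/
def witnessLang : Language := ⟨fun _ => Empty, WitnessRel⟩

instance witnessLangIsRelational : witnessLang.IsRelational := fun _ => inferInstanceAs (IsEmpty Empty)

/-- The disjoint union of two copies of the power set of the natural numbers. -/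
def TwoCopies : Type := Set ℕ ⊕ Set ℕ

/-- Each copy is ordered by inclusion, `U` is the first copy, and `R` is the bijection of the first
copy onto the second one that acts as the identity of the power set. -/
instance twoCopiesInst : witnessLang.Structure TwoCopies where
  funMap f _ := Empty.elim f
  RelMap {n} r := match n, r with
    | _, WitnessRel.le => fun x => Sum.LiftRel (· ⊆ ·) (· ⊆ ·) (x 0) (x 1)
    | _, WitnessRel.U => fun x => ∃ X : Set ℕ, x 0 = Sum.inl X
    | _, WitnessRel.R => fun x => ∃ X : Set ℕ, x 0 = Sum.inl X ∧ x 1 = Sum.inr X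

/-- Equality on the first copy and `=^*` on the second one. -/
def twoCopiesRel : TwoCopies → TwoCopies → Prop := Sum.LiftRel (· = ·) eqStar

/-- The disjoint union of the power set of the natural numbers and its quotient by `=^*`. -/
def PowersetAndQuotient : Type := Set ℕ ⊕ Quotient eqStar

/-- The summands carry inclusion and the induced order, `U` is the first summand, and `R` is the
canonical projection of the first summand onto the second one. -/
instance powersetAndQuotientInst : witnessLang.Structure PowersetAndQuotient where
  funMap f _ := Empty.elim f
  RelMap {n} r := match n, r with
    | _, WitnessRel.le => fun x => Sum.LiftRel (· ⊆ ·) leStar (x 0) (x 1)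
    | _, WitnessRel.U => fun x => ∃ X : Set ℕ, x 0 = Sum.inl X
    | _, WitnessRel.R => fun x =>
        ∃ X : Set ℕ, x 0 = Sum.inl X ∧ x 1 = Sum.inr (Quotient.mk eqStar X)

/-! The obstruction is descriptive: `=^*` is not smooth, that is, no Borel map into strings over a
finite alphabet has exactly its classes as fibres. A tail-invariant Borel set has coin-tossing
measure 0 or 1, so each letter of such a map is almost surely constant, hence so is the map,
although every class is countable and therefore null (`false_of_classifies_finite_ne`).

An abstract isomorphism from the quotient onto a Borel structure need not be Borel. The first
summand and `R` repair this. From the code of a set `X` one recovers `X` in a Borel way by comparing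
with the codes of the singletons, and this is injective on the graph of the projection. By the
Lusin–Souslin theorem, injective Borel images of Borel sets are Borel, so the code of `[X]` depends
on `X` in a Borel way, which contradicts non-smoothness
(`not_isBorelPresentable_powersetAndQuotient`).

Büchi presentations are Borel presentations because Büchi recognizable sets are Borel
(`measurableSet_acceptedSet`). This comes from a Ramsey argument on the finitely many profiles of
factors of a string: acceptance depends only on the profile of a prefix and on the profile repeated
afterwards.

The witnesses live on all binary strings: the first letter names the copy, the rest is a
characteristic function. Every relation needed is either a letterwise condition or one required from
some position on, and one four-state automaton handles them all. -/

namespace BuchiAutomaton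

/-! ### Profiles of factors and Ramsey factorizations -/

variable {α σ : Type}

/-- `M.Path w i j p q b`: on the factor of `w` from position `i` to position `j` the automaton can
go from `p` to `q`, through an accepting state if `b` is true. -/
def Path (M : BuchiAutomaton α σ) (w : ℕ → α) (i j : ℕ) (p q : σ) (b : Bool) : Prop :=
  ∃ ρ : ℕ → σ, ρ i = p ∧ ρ j = q ∧ (∀ k, i ≤ k → k < j → (ρ k, w k, ρ (k + 1)) ∈ M.trans) ∧
    (b = true → ∃ k, i ≤ k ∧ k < j ∧ ρ k ∈ M.accept)

variable {M : BuchiAutomaton α σ} {w w' : ℕ → α}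

theorem Path.congr {i j : ℕ} {p q : σ} {b : Bool} (h : ∀ k < j, w k = w' k)
    (hp : M.Path w i j p q b) : M.Path w' i j p q b := by
  obtain ⟨ρ, h0, h1, h2, h3⟩ := hp
  exact ⟨ρ, h0, h1, fun k hk hk' => h k hk' ▸ h2 k hk hk', h3⟩

theorem path_eq_of_prefix_eq {i j : ℕ} (h : ∀ k < j, w k = w' k) :
    M.Path w i j = M.Path w' i j := by
  ext p q b
  exact ⟨Path.congr h, Path.congr fun k hk => (h k hk).symm⟩

/-- Accepting states are sought at positions `i ≤ k < j` only, so adjacent factors share no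
position. The flag `false` imposes nothing, whence the implication rather than an equality of flags.
-/
theorem path_iff_concat {i j r : ℕ} (hij : i ≤ j) (hjr : j ≤ r) {p q : σ} {b : Bool} :
    M.Path w i r p q b ↔ ∃ t b₁ b₂, (b = true → b₁ = true ∨ b₂ = true) ∧
      M.Path w i j p t b₁ ∧ M.Path w j r t q b₂ := by
  constructor
  · rintro ⟨ρ, h0, h1, h2, h3⟩
    classical
    refine ⟨ρ j, decide (∃ k, i ≤ k ∧ k < j ∧ ρ k ∈ M.accept),
      decide (∃ k, j ≤ k ∧ k < r ∧ ρ k ∈ M.accept), ?_,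
      ⟨ρ, h0, rfl, fun k hk hk' => h2 k hk (by omega), by simp⟩,
      ⟨ρ, rfl, h1, fun k hk hk' => h2 k (by omega) hk', by simp⟩⟩
    intro hb
    obtain ⟨k, hk, hk', hk''⟩ := h3 hb
    simp only [decide_eq_true_eq]
    by_cases hkj : k < j
    · exact Or.inl ⟨k, hk, hkj, hk''⟩
    · exact Or.inr ⟨k, by omega, hk', hk''⟩
  · rintro ⟨t, b₁, b₂, hb, ⟨ρ, h0, h1, h2, h3⟩, ⟨ρ', h0', h1', h2', h3'⟩⟩
    have hlt : ∀ k, k ≤ j → (if k < j then ρ k else ρ' k) = ρ k := by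
      intro k hk
      rcases hk.lt_or_eq with hk | rfl
      · simp [hk]
      · simp [h1, h0']
    have hge : ∀ k, j ≤ k → (if k < j then ρ k else ρ' k) = ρ' k := by
      intro k hk
      simp [hk.not_gt]
    refine ⟨fun k => if k < j then ρ k else ρ' k, ?_, ?_, ?_, ?_⟩
    · simpa only [hlt i hij]
    · simpa only [hge r hjr]
    · intro k hk hk'
      by_cases hkj : k < j
      · simpa only [hlt k hkj.le, hlt (k + 1) hkj] using h2 k hk hkj
      · simpa only [hge k (by omega), hge (k + 1) (by omega)] using h2' k (by omega) hk'
    · intro hbt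
      rcases hb hbt with hb | hb
      · obtain ⟨k, hk, hk', hk''⟩ := h3 hb
        exact ⟨k, hk, by omega, by simpa only [hlt k hk'.le]⟩
      · obtain ⟨k, hk, hk', hk''⟩ := h3' hb
        exact ⟨k, by omega, hk', by simpa only [hge k hk]⟩

/-- Once two starting positions have merged they stay merged: cut every path at `j`. -/
theorem path_eq_of_path_eq {m n j r : ℕ} (hm : m ≤ j) (hn : n ≤ j) (hjr : j ≤ r)
    (h : M.Path w n j = M.Path w m j) : M.Path w n r = M.Path w m r := by
  ext p q b
  rw [path_iff_concat hn hjr, path_iff_concat hm hjr, h]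

theorem _root_.StrictMono.exists_block {g : ℕ → ℕ} (hg : StrictMono g) (h0 : g 0 = 0) (j : ℕ) :
    ∃ i, g i ≤ j ∧ j < g (i + 1) := by
  induction j with
  | zero => exact ⟨0, h0.le, h0.symm.trans_lt (hg Nat.zero_lt_one)⟩
  | succ j ih =>
    obtain ⟨i, h1, h2⟩ := ih
    by_cases h : j + 1 < g (i + 1)
    · exact ⟨i, by omega, h⟩
    · exact ⟨i + 1, by omega, by have := hg (Nat.lt_add_one (i + 1)); omega⟩

theorem _root_.StrictMono.block_unique {g : ℕ → ℕ} (hg : StrictMono g) {i i' j : ℕ}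
    (h1 : g i ≤ j) (h2 : j < g (i + 1)) (h1' : g i' ≤ j) (h2' : j < g (i' + 1)) : i = i' := by
  have := hg.lt_iff_lt.1 (h1.trans_lt h2')
  have := hg.lt_iff_lt.1 (h1'.trans_lt h2)
  omega

/-- By pigeonhole on the finitely many states, it need not be recorded which accepting state recurs.
-/
theorem accepts_iff [Finite σ] : M.Accepts w ↔
    ∃ q, M.IsRun w q ∧ ∃ᶠ i in atTop, q i ∈ M.accept := by
  constructor
  · rintro ⟨q, hq, s, hs, h⟩
    exact ⟨q, hq, h.mono fun i hi => hi ▸ hs⟩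
  · rintro ⟨q, hq, h⟩
    refine ⟨q, hq, ?_⟩
    by_contra! hc
    refine h ?_
    have : ∀ s : σ, ∀ᶠ i in atTop, s ∈ M.accept → q i ≠ s := by
      intro s
      by_cases hs : s ∈ M.accept
      · filter_upwards [hc s hs] with i hi _ using hi
      · exact Eventually.of_forall fun i h => (hs h).elim
    filter_upwards [eventually_all.2 this] with i hi hmem using hi _ hmem rfl

/-- Consecutive paths glue to an accepting run. -/
theorem accepts_of_paths [Finite σ] {g : ℕ → ℕ} (hg : StrictMono g) (h0 : g 0 = 0) {p : ℕ → σ}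
    {B : ℕ → Bool} (hp : p 0 = M.init)
    (h : ∀ i, M.Path w (g i) (g (i + 1)) (p i) (p (i + 1)) (B i))
    (hB : ∃ᶠ i in atTop, B i = true) : M.Accepts w := by
  choose ρ hρ0 hρ1 hρ2 hρ3 using h
  choose idx hidx1 hidx2 using hg.exists_block h0
  have hq : ∀ i k, g i ≤ k → k < g (i + 1) → ρ (idx k) k = ρ i k := by
    intro i k h1 h2
    rw [hg.block_unique (hidx1 k) (hidx2 k) h1 h2]
  -- At the right end of a block the glued run already follows the next piece; the two pieces agree
  -- there, at `p (i + 1)`.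
  have hq' : ∀ i k, g i ≤ k → k ≤ g (i + 1) → ρ (idx k) k = ρ i k := by
    intro i k h1 h2
    rcases h2.lt_or_eq with h2 | rfl
    · exact hq i k h1 h2
    · rw [hq (i + 1) _ le_rfl (hg (Nat.lt_succ_self _)), hρ0, hρ1]
  rw [accepts_iff]
  refine ⟨fun k => ρ (idx k) k, ⟨?_, ?_⟩, ?_⟩
  · have := hq 0 0 h0.le (h0.symm.trans_lt (hg Nat.zero_lt_one))
    simp only [this]
    rw [← hp, ← hρ0 0, h0]
  · intro k
    have h1 := hidx1 k
    have h2 := hidx2 k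
    simp only [hq' (idx k) (k + 1) (by omega) h2]
    exact hρ2 _ _ h1 h2
  · rw [frequently_atTop] at hB ⊢
    intro a
    obtain ⟨i, hi, hBi⟩ := hB a
    obtain ⟨k, hk1, hk2, hk3⟩ := hρ3 i hBi
    refine ⟨k, hi.trans ((hg.le_apply).trans hk1), ?_⟩
    simpa only [hq i k hk1 hk2]

/-- Infinitely many positions `m` after `n` have profile `e` from `n` and merge with `n`. -/
def Merges (M : BuchiAutomaton α σ) (w : ℕ → α) (n : ℕ) (e : σ → σ → Bool → Prop) : Prop :=
  ∀ a, ∃ m r, a ≤ m ∧ n < m ∧ m < r ∧ M.Path w n m = e ∧ M.Path w n r = M.Path w m r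

theorem Merges.exists_factorization {n : ℕ} (hn : 0 < n) {e : σ → σ → Bool → Prop}
    (h : M.Merges w n e) : ∃ g : ℕ → ℕ, StrictMono g ∧ g 0 = 0 ∧ g 1 = n ∧
      ∀ i, M.Path w (g (i + 1)) (g (i + 2)) = e := by
  let T := {m : ℕ // n < m ∧ M.Path w n m = e ∧ ∃ r, m < r ∧ M.Path w n r = M.Path w m r}
  have next : ∀ x : T, ∃ y : T, x.1 < y.1 ∧ M.Path w x.1 y.1 = e := by
    rintro ⟨m, hm, he, r, hmr, hr⟩
    obtain ⟨m', r', h1, h2, h3, h4, h5⟩ := h r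
    exact ⟨⟨m', h2, h4, r', h3, h5⟩, by simp only; omega, by
      -- The new cut `m'` lies beyond the position `r` where `m` and `n` merge, so the profile from
      -- `m` to `m'` is the one from `n`, namely `e`.
      rw [← path_eq_of_path_eq (by omega) (by omega) h1 hr, h4]⟩
  choose f hf1 hf2 using next
  obtain ⟨m, r, -, h2, h3, h4, h5⟩ := h 0
  let s : ℕ → T := fun i => f^[i] ⟨m, h2, h4, r, h3, h5⟩
  have hs : ∀ i, s (i + 1) = f (s i) := fun i => Function.iterate_succ_apply' _ _ _
  let g : ℕ → ℕ := fun i => match i with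
    | 0 => 0
    | 1 => n
    | i + 2 => (s i).1
  refine ⟨g, strictMono_nat_of_lt_succ ?_, rfl, rfl, ?_⟩
  · rintro (_ | _ | i)
    · exact hn
    · exact h2
    · change (s i).1 < (s (i + 1)).1
      rw [hs]
      exact hf1 _
  · rintro (_ | i)
    · exact h4
    · change M.Path w (s i).1 (s (i + 1)).1 = e
      rw [hs]
      exact hf2 _

/-- The Ramsey step, by limits along a nonprincipal ultrafilter. There are finitely many profiles,
so the profile from `m` to `x` has a limit `v m` in `x`, and `v` has a limit `e`; any positive `n`
with `v n = e` works. -/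
theorem exists_merges [Finite σ] (M : BuchiAutomaton α σ) (w : ℕ → α) :
    ∃ n e, 0 < n ∧ M.Merges w n e := by
  have lim : ∀ f : ℕ → (σ → σ → Bool → Prop), ∃ s, ∀ᶠ x in (hyperfilter ℕ : Filter ℕ), f x = s := by
    intro f
    obtain ⟨s, hs⟩ := Ultrafilter.eq_pure_of_finite ((hyperfilter ℕ).map f)
    refine ⟨s, ?_⟩
    have : {s} ∈ (hyperfilter ℕ).map f := by rw [hs]; exact Set.mem_singleton s
    exact this
  have large : ∀ a : ℕ, ∀ᶠ x in (hyperfilter ℕ : Filter ℕ), a < x := fun a =>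
    (Nat.hyperfilter_le_atTop) (eventually_gt_atTop a)
  choose v hv using fun m => lim (M.Path w m)
  obtain ⟨e, he⟩ := lim v
  obtain ⟨n, hne, hn⟩ := (he.and (large 0)).exists
  refine ⟨n, e, hn, fun a => ?_⟩
  obtain ⟨m, ⟨h1, h2⟩, h3⟩ := (((hv n).and he).and ((large a).and (large n))).exists
  obtain ⟨r, ⟨h5, h6⟩, h7⟩ := (((hv n).and (hv m)).and (large m)).exists
  exact ⟨m, r, h3.1.le, h3.2, h7, h1.trans hne, by rw [h5, h6, hne, h2]⟩

/-- Both strings factor into blocks with the same sequence of profiles, so an accepting run on one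
can be replaced block by block, keeping the states at the cuts and the visits to accepting states.
-/
theorem Accepts.transfer [Finite σ] {n n' : ℕ} (hn : 0 < n) (hn' : 0 < n')
    {e : σ → σ → Bool → Prop} (h : M.Merges w n e) (h' : M.Merges w' n' e)
    (hp : M.Path w 0 n = M.Path w' 0 n') (hw : M.Accepts w) : M.Accepts w' := by
  classical
  obtain ⟨g, hg, hg0, hg1, hge⟩ := h.exists_factorization hn
  obtain ⟨g', hg', hg0', hg1', hge'⟩ := h'.exists_factorization hn'
  obtain ⟨q, hq, hacc⟩ := accepts_iff.1 hw
  have hpath : ∀ i, M.Path w (g i) (g (i + 1)) = M.Path w' (g' i) (g' (i + 1)) := by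
    rintro (_ | i)
    · simpa only [hg0, hg0', zero_add, hg1, hg1'] using hp
    · rw [hge, hge']
  refine accepts_of_paths hg' hg0' (p := fun i => q (g i))
    (B := fun i => decide (∃ k, g i ≤ k ∧ k < g (i + 1) ∧ q k ∈ M.accept)) ?_ ?_ ?_
  · simp only [hg0, hq.1]
  · intro i
    rw [← hpath]
    exact ⟨q, rfl, rfl, fun k _ _ => hq.2 k, by simp⟩
  · rw [frequently_atTop] at hacc ⊢
    intro a
    obtain ⟨k, hk, hk'⟩ := hacc (g a)
    obtain ⟨i, h1, h2⟩ := hg.exists_block hg0 k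
    have := hg.lt_iff_lt.1 (hk.trans_lt h2)
    exact ⟨i, by omega, by simpa using ⟨k, h1, h2, hk'⟩⟩

end BuchiAutomaton

/-! ### Büchi recognizable sets are Borel -/

theorem isOpen_setOf_of_prefix {α : Type} [TopologicalSpace α] [DiscreteTopology α]
    {P : (ℕ → α) → Prop} (j : ℕ) (h : ∀ w w', (∀ k < j, w k = w' k) → P w → P w') :
    IsOpen {w | P w} := by
  rw [isOpen_iff_mem_nhds]
  intro w hw
  have : ∀ᶠ w' in nhds w, ∀ k ∈ Finset.range j, w k = w' k := by
    rw [eventually_all_finset]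
    intro k _
    have hk : ∀ᶠ a in nhds (w k), w k = a := by simp [nhds_discrete]
    exact (continuous_apply k).continuousAt.eventually hk
  filter_upwards [this] with w' hw'
  exact h w w' (fun k hk => hw' k (Finset.mem_range.2 hk)) hw

namespace BuchiAutomaton

variable {α σ : Type} {M : BuchiAutomaton α σ}

theorem measurableSet_merges [TopologicalSpace α] [DiscreteTopology α] (n : ℕ)
    (e : σ → σ → Bool → Prop) : @MeasurableSet _ (borel (ℕ → α)) {w | M.Merges w n e} := by
  borelize (ℕ → α)
  have : {w | M.Merges w n e} = ⋂ a, ⋃ m, ⋃ r, {w | a ≤ m ∧ n < m ∧ m < r ∧ M.Path w n m = e ∧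
      M.Path w n r = M.Path w m r} := by
    ext w
    simp [Merges]
  rw [this]
  refine .iInter fun a => .iUnion fun m => .iUnion fun r =>
    (isOpen_setOf_of_prefix r ?_).measurableSet
  rintro w w' h ⟨h1, h2, h3, h4, h5⟩
  refine ⟨h1, h2, h3, ?_, ?_⟩
  · rw [← h4, path_eq_of_prefix_eq fun k hk => (h k (hk.trans h3)).symm]
  · rwa [← path_eq_of_prefix_eq h, ← path_eq_of_prefix_eq h]

/-- Every string has some data `(n, s, e)`, and by `Accepts.transfer` the pair `(s, e)` decides
acceptance. The last set of each intersection does not depend on the string: it only selects the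
pairs realized by an accepted one. -/
theorem measurableSet_acceptedSet [TopologicalSpace α] [DiscreteTopology α] [Finite σ]
    (M : BuchiAutomaton α σ) : @MeasurableSet _ (borel (ℕ → α)) M.acceptedSet := by
  have : M.acceptedSet = ⋃ n : ℕ, ⋃ s : σ → σ → Bool → Prop, ⋃ e : σ → σ → Bool → Prop,
      {w | M.Path w 0 n = s} ∩ {w | M.Merges w n e} ∩
        {_w | 0 < n ∧ ∃ w', M.Accepts w' ∧ ∃ n' > 0, M.Path w' 0 n' = s ∧ M.Merges w' n' e} := by
    ext w
    simp only [Set.mem_iUnion, Set.mem_inter_iff, Set.mem_ofPred_eq]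
    constructor
    · intro hw
      obtain ⟨n, e, hn, h⟩ := M.exists_merges w
      exact ⟨n, _, e, ⟨rfl, h⟩, hn, w, hw, n, hn, rfl, h⟩
    · rintro ⟨n, s, e, ⟨h1, h2⟩, hn, w', hw', n', hn', h1', h2'⟩
      exact hw'.transfer hn' hn h2' h2 (h1'.trans h1.symm)
  rw [this]
  borelize (ℕ → α)
  refine .iUnion fun n => .iUnion fun s => .iUnion fun e => .inter (.inter ?_ ?_) (.const _)
  · refine (isOpen_setOf_of_prefix n fun w w' h hs => ?_).measurableSet
    rw [← hs, path_eq_of_prefix_eq fun k hk => (h k hk).symm]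
  · exact measurableSet_merges n e

end BuchiAutomaton

theorem IsBuchiRecognizable.isBorelStringSet {α : Type} {W : Set (ℕ → α)}
    (h : IsBuchiRecognizable W) : IsBorelStringSet W := by
  obtain ⟨σ, _, M, rfl⟩ := h
  let : TopologicalSpace α := ⊥
  have : DiscreteTopology α := ⟨rfl⟩
  exact M.measurableSet_acceptedSet

theorem convolution_injective {α : Type} {k : ℕ} :
    Function.Injective (convolution (α := α) (k := k)) := fun x y h => by
  ext j i
  exact congrFun (congrFun h i) j

theorem IsBuchiRecognizableRel.isBorelStringRel {α : Type} {k : ℕ} {R : Set (Fin k → ℕ → α)}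
    [Finite α] (h : IsBuchiRecognizableRel R) : IsBorelStringRel R := by
  obtain ⟨σ, _, M, hM⟩ := h
  let : TopologicalSpace α := ⊥
  have : DiscreteTopology α := ⟨rfl⟩
  have hR : R = convolution ⁻¹' M.acceptedSet := by
    rw [hM, convolution_injective.preimage_image]
  have hc : Continuous (convolution (α := α) (k := k)) := by
    unfold convolution
    fun_prop
  have hm := M.measurableSet_acceptedSet
  unfold IsBorelStringRel
  rw [hR]
  borelize (ℕ → Fin k → α) (Fin k → ℕ → α)
  exact hc.measurable hm

theorem IsBuchiPresentable.isBorelPresentable {L : Language} [L.IsRelational] {M : Type}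
    [L.Structure M] (h : IsBuchiPresentable L M) : IsBorelPresentable L M := by
  obtain ⟨α, hα, D, S, hD, e⟩ := h
  exact ⟨α, hα, D, S, ⟨hD.nonempty, hD.domain.isBorelStringSet,
    fun r => (hD.relations r).isBorelStringRel⟩, e⟩

/-! ### Non-smoothness of equality modulo finite sets -/

open MeasureTheory ProbabilityTheory

/-- The distribution of an infinite sequence of fair coin tosses. -/
noncomputable def coinMeasure : Measure (ℕ → Bool) :=
  Measure.infinitePi fun _ : ℕ => (PMF.uniformOfFintype Bool).toMeasure

instance : MeasureTheory.IsProbabilityMeasure coinMeasure := by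
  unfold coinMeasure; infer_instance

theorem coinMeasure_countable {s : Set (ℕ → Bool)} (hs : s.Countable) : coinMeasure s = 0 := by
  refine (measure_null_iff_singleton hs).2 fun z _ => ?_
  have hle : ∀ n : ℕ, coinMeasure {z} ≤ (2⁻¹ : ENNReal) ^ n := by
    intro n
    calc coinMeasure {z} ≤ coinMeasure (Set.pi (Finset.range n) fun i => {z i}) :=
          measure_mono fun x hx i _ => by rw [Set.mem_singleton_iff.1 hx]; rfl
      _ = (2⁻¹ : ENNReal) ^ n := by
          rw [coinMeasure, Measure.infinitePi_pi _ fun i _ => measurableSet_singleton _]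
          simp
  exact le_antisymm (ge_of_tendsto'
    (ENNReal.tendsto_pow_atTop_nhds_zero_of_lt_one (by simp)) hle) zero_le

/-- Kolmogorov's zero-one law for the independent coordinates. -/
theorem coinMeasure_zero_or_one {T : Set (ℕ → Bool)} (hT : MeasurableSet T)
    (h : ∀ x ∈ T, ∀ y, {n | x n ≠ y n}.Finite → y ∈ T) : coinMeasure T = 0 ∨ coinMeasure T = 1 := by
  have hind : iIndepFun (fun (n : ℕ) (x : ℕ → Bool) => x n) coinMeasure :=
    iIndepFun_infinitePi (X := fun _ b => b) (fun _ => measurable_id)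
  refine measure_zero_or_one_of_measurableSet_limsup_atTop
    (s := fun n => MeasurableSpace.comap (fun x : ℕ → Bool => x n) inferInstance)
    (fun n => (measurable_pi_apply n).comap_le) hind ?_
  rw [limsup_eq_iInf_iSup_of_nat, MeasurableSpace.measurableSet_iInf]
  intro n
  -- Erasing the first `n` coordinates does not affect membership, so `T` is measurable with respect
  -- to the coordinates from `n` on.
  have hpre : T = (fun x k => if k < n then false else x k) ⁻¹' T := by
    ext x
    have hfin : {k | x k ≠ if k < n then false else x k}.Finite :=
      (Set.finite_lt_nat n).subset fun k hk => by
        by_contra hc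
        simp_all
    refine ⟨fun hx => h x hx _ hfin, fun hx => h _ hx x ?_⟩
    exact hfin.subset fun k hk => Ne.symm hk
  rw [hpre]
  refine @MeasurableSet.preimage _ _ (_) _ _ _ hT ?_
  refine @measurable_pi_lambda _ _ _ (_) _ _ fun k => ?_
  by_cases hk : k < n
  · simp only [hk, if_true]
    exact measurable_const
  · simp only [hk, if_false]
    exact (comap_measurable _).mono (le_iSup₂_of_le k (not_lt.1 hk) le_rfl) le_rfl

/-- Taking the set of differences from `z` embeds the class into the countable family of finite
subsets of `ℕ`. -/
theorem countable_setOf_finite_ne (z : ℕ → Bool) : {x : ℕ → Bool | {n | x n ≠ z n}.Finite}.Countable := by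
  have : Set.InjOn (fun x : ℕ → Bool => {n | x n ≠ z n}) {x | {n | x n ≠ z n}.Finite} := by
    intro x _ y _ hxy
    ext n
    have := Set.ext_iff.1 hxy n
    simp only [Set.mem_ofPred_eq] at this
    revert this
    cases x n <;> cases y n <;> cases z n <;> simp
  exact (Set.Countable.ofPred_finite (α := ℕ)).preimage_of_injOn this |>.mono fun x hx => hx

/-- The relation `=^*` is not smooth: no map to infinite strings that classifies it up to `=^*`
has measurable fibres at every position. -/
theorem false_of_classifies_finite_ne {α : Type} [Finite α] (f : (ℕ → Bool) → ℕ → α)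
    (hf : ∀ x y, f x = f y ↔ {n | x n ≠ y n}.Finite)
    (hm : ∀ n a, MeasurableSet {x | f x n = a}) : False := by
  have key : ∀ n, ∃ a, ∀ᵐ x ∂coinMeasure, f x n = a := by
    intro n
    by_contra! hc
    -- If no letter had full measure, each would almost surely be avoided, and by finiteness of `α`
    -- all of them at once.
    have h0 : ∀ a, ∀ᵐ x ∂coinMeasure, f x n ≠ a := by
      intro a
      have := coinMeasure_zero_or_one (hm n a) (fun x hx y hxy => by
        have := (hf x y).2 hxy
        simpa [← this] using hx)
      rcases this with h | h
      · simpa [ae_iff] using h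
      · exact absurd ((prob_compl_eq_zero_iff (hm n a)).2 h) fun h' => hc a (by simpa [ae_iff] using! h')
    obtain ⟨x, hx⟩ := (ae_all_iff.2 h0).exists
    exact hx _ rfl
  choose z hz using key
  have hz' : ∀ᵐ x ∂coinMeasure, f x = z := by
    filter_upwards [ae_all_iff.2 hz] with x hx using funext hx
  obtain ⟨x₀, hx₀⟩ := hz'.exists
  have hnull : ∀ᵐ x ∂coinMeasure, ¬ {n | x n ≠ x₀ n}.Finite := by
    have := coinMeasure_countable (countable_setOf_finite_ne x₀)
    simpa [ae_iff] using this
  obtain ⟨x, hx, hx'⟩ := (hz'.and hnull).exists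
  exact hx' ((hf x x₀).1 (hx.trans hx₀.symm))

/-! ### The quotient is not Borel presentable -/

/-- The symbol `≤` of the witness language. -/
def leSymbol : witnessLang.Relations 2 := WitnessRel.le

/-- The symbol `R` of the witness language. -/
def projSymbol : witnessLang.Relations 2 := WitnessRel.R

theorem mem_relSet_iff {L : Language} {X : Type} {D : Set X} [L.Structure D] {n : ℕ}
    {r : L.Relations n} {y : Fin n → D} :
    (fun i => (y i : X)) ∈ relSet L D r ↔ Language.Structure.RelMap r y := by
  refine ⟨?_, fun h => ⟨y, h, rfl⟩⟩
  rintro ⟨y', h, hy⟩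
  have : y' = y := by
    ext i
    exact congrFun hy i
  rwa [← this]

theorem not_isBorelPresentable_powersetAndQuotient :
    ¬ IsBorelPresentable witnessLang PowersetAndQuotient := by
  classical
  rintro ⟨α, _, D, _, hD, ⟨φ⟩⟩
  let : TopologicalSpace α := ⊥
  have : DiscreteTopology α := ⟨rfl⟩
  let : MeasurableSpace α := borel α
  have : BorelSpace α := ⟨rfl⟩
  have hLE : MeasurableSet (relSet witnessLang D leSymbol) := by
    rw [BorelSpace.measurable_eq (α := Fin 2 → ℕ → α)]
    exact hD.relations leSymbol
  have hR : MeasurableSet (relSet witnessLang D projSymbol) := by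
    rw [BorelSpace.measurable_eq (α := Fin 2 → ℕ → α)]
    exact hD.relations projSymbol
  let c : Set ℕ → D := fun X => φ (Sum.inl X : PowersetAndQuotient)
  let d : Set ℕ → D := fun X => φ (Sum.inr (Quotient.mk eqStar X) : PowersetAndQuotient)
  have hdd : ∀ X Y, d X = d Y ↔ (symmDiff X Y).Finite := by
    intro X Y
    refine (φ.injective.eq_iff).trans ?_
    exact (Sum.inr_injective.eq_iff).trans Quotient.eq
  have memR : ∀ v, v ∈ relSet witnessLang D projSymbol ↔
      ∃ X, v = ![(c X : ℕ → α), (d X : ℕ → α)] := by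
    intro v
    constructor
    · rintro ⟨y, hy, rfl⟩
      obtain ⟨y, rfl⟩ : ∃ y', y = φ ∘ y' := ⟨φ.symm ∘ y, by ext; simp⟩
      have hy' : Language.Structure.RelMap projSymbol (φ ∘ y) := hy
      rw [φ.map_rel] at hy'
      obtain ⟨X, h0, h1⟩ := hy'
      refine ⟨X, ?_⟩
      ext i
      fin_cases i
      · simp [c, h0]
      · simp [d, h1]
    · rintro ⟨X, rfl⟩
      refine ⟨φ ∘ ![(Sum.inl X : PowersetAndQuotient), (Sum.inr (Quotient.mk eqStar X) :)], ?_, ?_⟩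
      · change Language.Structure.RelMap projSymbol (φ ∘ _)
        rw [φ.map_rel]
        exact ⟨X, rfl, rfl⟩
      · ext i
        fin_cases i <;> rfl
  have memLE : ∀ X Y, ![(c X : ℕ → α), (c Y : ℕ → α)] ∈
      relSet witnessLang D leSymbol ↔ X ⊆ Y := by
    intro X Y
    have h := mem_relSet_iff (L := witnessLang) (D := D) (r := leSymbol)
      (y := φ ∘ ![(Sum.inl X : PowersetAndQuotient), (Sum.inl Y : PowersetAndQuotient)])
    rw [φ.map_rel] at h
    have hv : (fun i => (((φ ∘ ![(Sum.inl X : PowersetAndQuotient), (Sum.inl Y :)]) i : D) : ℕ → α))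
        = ![(c X : ℕ → α), (c Y : ℕ → α)] := by
      ext i
      fin_cases i <;> rfl
    rw [hv] at h
    refine h.trans ?_
    change Sum.LiftRel _ _ (Sum.inl X) (Sum.inl Y) ↔ _
    simp
  -- Since `n ∈ X` iff `{n} ⊆ X`, comparison with the codes of singletons reads `X` off its code.
  let h : (Fin 2 → ℕ → α) → ℕ → Bool := fun v n =>
    decide (![(c {n} : ℕ → α), v 0] ∈ relSet witnessLang D leSymbol)
  have hc : ∀ X n, h ![(c X : ℕ → α), (d X : ℕ → α)] n = decide (n ∈ X) := by
    intro X n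
    simp [h, memLE]
  have hmeas : Measurable h := by
    refine measurable_pi_lambda _ fun n => ?_
    refine measurable_to_bool ?_
    have : Measurable fun v : Fin 2 → ℕ → α => ![(c {n} : ℕ → α), v 0] := by
      refine measurable_pi_lambda _ fun i => ?_
      fin_cases i
      · exact measurable_const
      · exact measurable_pi_apply _
    convert this hLE using 1
    ext v
    simp [h]
  have hinj : Set.InjOn h (relSet witnessLang D projSymbol) := by
    intro v hv v' hv' hvv'
    obtain ⟨X, rfl⟩ := (memR v).1 hv
    obtain ⟨Y, rfl⟩ := (memR v').1 hv'
    have : X = Y := by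
      ext n
      have := congrFun hvv' n
      simpa [hc] using this
    rw [this]
  refine false_of_classifies_finite_ne (fun x => (d {n | x n = true} : ℕ → α)) ?_ ?_
  · intro x y
    rw [Subtype.val_injective.eq_iff, hdd]
    have : symmDiff {n | x n = true} {n | y n = true} = {n | x n ≠ y n} := by
      ext n
      simp only [Set.mem_symmDiff, Set.mem_ofPred_eq]
      cases x n <;> cases y n <;> simp
    rw [this]
  · intro n a
    have hS : MeasurableSet (relSet witnessLang D projSymbol ∩ {v | v 1 n = a}) := by
      refine hR.inter ?_
      have : Measurable fun v : Fin 2 → ℕ → α => v 1 n := by fun_prop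
      exact this (measurableSet_singleton a)
    -- Lusin–Souslin: the fibre of the code of `[X]` at position `n` is the injective image under
    -- `h` of a Borel part of the graph of the projection.
    convert hS.image_of_measurable_injOn hmeas (hinj.mono Set.inter_subset_left) using 1
    ext x
    constructor
    · intro hx
      refine ⟨_, ⟨(memR _).2 ⟨{n | x n = true}, rfl⟩, hx⟩, ?_⟩
      ext k
      simp [hc]
    · rintro ⟨v, ⟨hv, hva⟩, rfl⟩
      obtain ⟨X, rfl⟩ := (memR v).1 hv
      simpa [hc] using hva

theorem IsBorelPresentable.congr {L : Language} [L.IsRelational] {M N : Type} [L.Structure M]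
    [L.Structure N] (e : M ≃[L] N) (h : IsBorelPresentable L M) : IsBorelPresentable L N := by
  obtain ⟨α, hα, D, S, hD, ⟨φ⟩⟩ := h
  exact ⟨α, hα, D, S, hD, ⟨φ.comp e.symm⟩⟩

/-! ### One automaton for all the relations -/

/-- An automaton for the words whose first letter satisfies `I` and whose other letters satisfy `P`,
or whose first letter satisfies `J` and all but finitely many of whose letters satisfy `Q`. -/
def safetyOrEventually {β : Type} (I P J Q : β → Prop) : BuchiAutomaton β (Fin 4) where
  init := 0
  trans := {x | (x.1 = 0 ∧ x.2.2 = 1 ∧ I x.2.1) ∨ (x.1 = 1 ∧ x.2.2 = 1 ∧ P x.2.1) ∨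
    (x.1 = 0 ∧ x.2.2 = 2 ∧ J x.2.1) ∨ (x.1 = 2 ∧ x.2.2 = 2) ∨ (x.1 = 2 ∧ x.2.2 = 3) ∨
    (x.1 = 3 ∧ x.2.2 = 3 ∧ Q x.2.1)}
  accept := {1, 3}

/-- State 1 checks `P` forever. State 2 waits, and the nondeterministic move to state 3 guesses that
only letters satisfying `Q` follow; since 2 is not accepting, this guess must be made. -/
theorem isBuchiRecognizable_safety_or_eventually {β : Type} (I P J Q : β → Prop) :
    IsBuchiRecognizable {w : ℕ → β | (I (w 0) ∧ ∀ n, P (w (n + 1))) ∨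
      (J (w 0) ∧ ∀ᶠ n in atTop, Q (w n))} := by
  refine ⟨Fin 4, inferInstance, safetyOrEventually I P J Q, ?_⟩
  ext w
  change (safetyOrEventually I P J Q).Accepts w ↔ _
  rw [BuchiAutomaton.accepts_iff]
  constructor
  · rintro ⟨q, ⟨h0, hq⟩, hacc⟩
    simp only [safetyOrEventually, Set.mem_ofPred_eq] at h0 hq
    have h01 := hq 0
    simp only [h0, zero_add] at h01
    have h1 : (q 1 = 1 ∧ I (w 0)) ∨ (q 1 = 2 ∧ J (w 0)) := by simpa using h01
    rcases h1 with ⟨h1, hI⟩ | ⟨h1, hJ⟩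
    · refine Or.inl ⟨hI, ?_⟩
      have hq1 : ∀ n, q (n + 1) = 1 := by
        intro n
        induction n with
        | zero => exact h1
        | succ n ih => have := hq (n + 1); simp_all
      intro n
      have := hq (n + 1)
      simp_all
    · refine Or.inr ⟨hJ, ?_⟩
      have hq2 : ∀ n, q (n + 1) = 2 ∨ q (n + 1) = 3 := by
        intro n
        induction n with
        | zero => exact Or.inl h1
        | succ n ih =>
          have := hq (n + 1)
          rcases ih with ih | ih <;> simp [ih] at this <;> tauto
      obtain ⟨m, hm, hm'⟩ := frequently_atTop.1 hacc 1
      obtain ⟨m, rfl⟩ : ∃ k, m = k + 1 := ⟨m - 1, by omega⟩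
      have hm3 : q (m + 1) = 3 := by
        rcases hq2 m with h | h
        · simp [h, safetyOrEventually] at hm'
        · exact h
      have hq3 : ∀ n, m + 1 ≤ n → q n = 3 := by
        intro n hn
        induction n, hn using Nat.le_induction with
        | base => exact hm3
        | succ n hn ih => have := hq n; simp_all
      filter_upwards [eventually_ge_atTop (m + 1)] with n hn
      have := hq n
      simpa [hq3 n hn, hq3 (n + 1) (by omega)] using this
  · rintro (⟨hI, hP⟩ | ⟨hJ, hQ⟩)
    · refine ⟨fun n => if n = 0 then 0 else 1, ⟨rfl, ?_⟩, ?_⟩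
      · rintro (_ | n)
        · simp [safetyOrEventually, hI]
        · simp [safetyOrEventually, hP]
      · refine Eventually.frequently ?_
        filter_upwards [eventually_ge_atTop 1] with n hn
        simp [safetyOrEventually, Nat.one_le_iff_ne_zero.1 hn]
    · obtain ⟨N, hN⟩ := eventually_atTop.1 hQ
      -- Waiting through position `N + 1` ensures a visit to state 2 at position 1 even when `N =
      -- 0`.
      refine ⟨fun n => if n = 0 then 0 else if n ≤ N + 1 then 2 else 3, ⟨rfl, ?_⟩, ?_⟩
      · rintro (_ | n)
        · simp [safetyOrEventually, hJ]
        · by_cases h1 : n + 1 ≤ N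
          · simp [safetyOrEventually, h1, Nat.le_of_succ_le h1]
          · by_cases h2 : n ≤ N
            · simp [safetyOrEventually, h1, h2]
            · simp [safetyOrEventually, h1, h2, hN (n + 1) (by omega)]
      · refine Eventually.frequently ?_
        filter_upwards [eventually_ge_atTop (N + 2)] with n hn
        have h1 : n ≠ 0 := by omega
        have h2 : ¬ n ≤ N + 1 := by omega
        simp [safetyOrEventually, h1, h2]

theorem isBuchiRecognizableRel_of_iff {α : Type} {k : ℕ} {R : Set (Fin k → ℕ → α)}
    (I P J Q : (Fin k → α) → Prop)
    (h : ∀ x, x ∈ R ↔ (I (fun j => x j 0) ∧ ∀ n, P (fun j => x j (n + 1))) ∨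
      (J (fun j => x j 0) ∧ ∀ᶠ n in atTop, Q (fun j => x j n))) :
    IsBuchiRecognizableRel R := by
  have : convolution '' R = {w | (I (w 0) ∧ ∀ n, P (w (n + 1))) ∨
      (J (w 0) ∧ ∀ᶠ n in atTop, Q (w n))} := by
    ext w
    constructor
    · rintro ⟨x, hx, rfl⟩
      exact (h x).1 hx
    · intro hw
      exact ⟨fun j i => w i j, (h _).2 hw, rfl⟩
  unfold IsBuchiRecognizableRel
  rw [this]
  exact isBuchiRecognizable_safety_or_eventually I P J Q

/-! ### Coding two copies of the power set by binary strings -/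

/-- The set coded by an infinite string: the first letter is skipped. -/
def wordSet (w : ℕ → Bool) : Set ℕ := {n | w (n + 1) = true}

/-- The element of the disjoint union of two power sets that is coded by an infinite string: the
first letter selects the copy. -/
def decode (w : (Set.univ : Set (ℕ → Bool))) : Set ℕ ⊕ Set ℕ :=
  if w.1 0 = true then Sum.inl (wordSet w) else Sum.inr (wordSet w)

theorem decode_bijective : Function.Bijective decode := by
  classical
  constructor
  · rintro ⟨w, _⟩ ⟨v, _⟩ h
    have key : w 0 = v 0 ∧ wordSet w = wordSet v := by
      unfold decode at h
      cases hw : w 0 <;> cases hv : v 0 <;> simp_all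
    ext n
    rcases n with _ | n
    · exact key.1
    · have := Set.ext_iff.1 key.2 n
      exact Bool.eq_iff_iff.2 this
  · have hset : ∀ b X, wordSet (fun n => Nat.casesOn n b fun n => decide (n ∈ X)) = X := by
      intro b X
      ext n
      simp [wordSet]
    rintro (X | X)
    · exact ⟨⟨fun n => Nat.casesOn n true fun n => decide (n ∈ X), trivial⟩, by
        simp only [decode, hset]; simp⟩
    · exact ⟨⟨fun n => Nat.casesOn n false fun n => decide (n ∈ X), trivial⟩, by
        simp only [decode, hset]; simp⟩

theorem liftRel_decode_iff {A B : Set ℕ → Set ℕ → Prop} {w v : (Set.univ : Set (ℕ → Bool))} :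
    Sum.LiftRel A B (decode w) (decode v) ↔
      ((w.1 0 = true ∧ v.1 0 = true) ∧ A (wordSet w) (wordSet v)) ∨
      ((w.1 0 = false ∧ v.1 0 = false) ∧ B (wordSet w) (wordSet v)) := by
  unfold decode
  cases hw : w.1 0 <;> cases hv : v.1 0 <;> simp

theorem exists_decode_eq_inl_iff {w : (Set.univ : Set (ℕ → Bool))} :
    (∃ X, decode w = Sum.inl X) ↔ w.1 0 = true := by
  unfold decode
  cases hw : w.1 0 <;> simp

theorem exists_decode_eq_inl_inr_iff {A : Set ℕ → Set ℕ → Prop}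
    {w v : (Set.univ : Set (ℕ → Bool))} :
    (∃ X Y, A X Y ∧ decode w = Sum.inl X ∧ decode v = Sum.inr Y) ↔
      (w.1 0 = true ∧ v.1 0 = false) ∧ A (wordSet w) (wordSet v) := by
  unfold decode
  cases hw : w.1 0 <;> cases hv : v.1 0 <;> simp

/-- The shift caused by the selector letter is invisible to eventual properties. -/
theorem finite_setOf_not_succ_iff {p : ℕ → Prop} :
    {n | ¬ p (n + 1)}.Finite ↔ ∀ᶠ n in atTop, p n := by
  rw [← map_add_atTop_eq_nat 1, eventually_map, ← Nat.cofinite_eq_atTop, eventually_cofinite]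

theorem wordSet_subset_iff {w v : ℕ → Bool} :
    wordSet w ⊆ wordSet v ↔ ∀ n, w (n + 1) = true → v (n + 1) = true := Iff.rfl

theorem wordSet_eq_iff {w v : ℕ → Bool} :
    wordSet w = wordSet v ↔ ∀ n, w (n + 1) = v (n + 1) := by
  rw [Set.ext_iff]
  exact forall_congr' fun n => Bool.eq_iff_iff.symm

theorem wordSet_diff_finite_iff {w v : ℕ → Bool} :
    (wordSet w \ wordSet v).Finite ↔ ∀ᶠ n in atTop, w n = true → v n = true := by
  rw [← finite_setOf_not_succ_iff]
  simp only [Classical.not_imp]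
  rfl

theorem wordSet_symmDiff_finite_iff {w v : ℕ → Bool} :
    (symmDiff (wordSet w) (wordSet v)).Finite ↔ ∀ᶠ n in atTop, w n = v n := by
  rw [← finite_setOf_not_succ_iff]
  have : symmDiff (wordSet w) (wordSet v) = {n | ¬ w (n + 1) = v (n + 1)} := by
    ext n
    simp only [Set.mem_symmDiff, wordSet, Set.mem_ofPred_eq]
    cases w (n + 1) <;> cases v (n + 1) <;> simp
  rw [this]

theorem mem_relSet_univ_iff {L : Language} {X : Type} [L.Structure (Set.univ : Set X)] {n : ℕ}
    {r : L.Relations n} {x : Fin n → X} :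
    x ∈ relSet L Set.univ r ↔
      Language.Structure.RelMap r (fun i => (⟨x i, trivial⟩ : (Set.univ : Set X))) :=
  mem_relSet_iff (y := fun i => (⟨x i, trivial⟩ : (Set.univ : Set X)))

/-! ### The equivalence relation and the two automatic structures -/

/-- The identity on the first copy and the projection modulo finite sets on the second one. -/
def collapse : Set ℕ ⊕ Set ℕ → PowersetAndQuotient := Sum.map id (Quotient.mk eqStar)

theorem collapse_surjective : Function.Surjective collapse :=
  Sum.map_surjective.2 ⟨Function.surjective_id, Quotient.mk_surjective⟩

theorem collapse_eq_iff {a b : Set ℕ ⊕ Set ℕ} :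
    collapse a = collapse b ↔ Sum.LiftRel (· = ·) eqStar a b := by
  rcases a with X | X <;> rcases b with Y | Y
  · rw [Sum.liftRel_inl_inl]
    exact Sum.inl_injective.eq_iff
  · simp [collapse]
  · simp [collapse]
  · rw [Sum.liftRel_inr_inr]
    exact (Sum.inr_injective.eq_iff).trans Quotient.eq

/-- A surjection onto `N` with kernel `E` that carries the basic relations of `M` onto those of `N`
identifies the quotient of `M` by `E` with `N`. -/
theorem nonempty_quotient_equiv {L : Language} [L.IsRelational] {M N : Type} [L.Structure M]
    [L.Structure N] {E : Setoid M} (f : M → N) (hf : Function.Surjective f)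
    (hE : ∀ a b, E a b ↔ f a = f b)
    (hrel : ∀ {n : ℕ} (r : L.Relations n) (x : Fin n → N), Language.Structure.RelMap r x ↔
      ∃ y : Fin n → M, (∀ i, f (y i) = x i) ∧ Language.Structure.RelMap r y) :
    Nonempty (QuotientStructure L E ≃[L] N) := by
  let g : QuotientStructure L E → N := Quotient.lift f fun a b h => (hE a b).1 h
  have hg : ∀ a, g (Quotient.mk E a) = f a := fun _ => rfl
  have hinj : Function.Injective g := by
    rintro ⟨a⟩ ⟨b⟩ h
    exact Quotient.sound ((hE a b).2 h)
  have hsurj : Function.Surjective g := fun y => by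
    obtain ⟨a, rfl⟩ := hf y
    exact ⟨Quotient.mk E a, rfl⟩
  refine ⟨⟨Equiv.ofBijective g ⟨hinj, hsurj⟩, fun F => isEmptyElim F, fun r x => ?_⟩⟩
  refine (hrel r _).trans (exists_congr fun y => and_congr_left fun _ => forall_congr' fun i => ?_)
  rw [← hg]
  exact hinj.eq_iff

/-- The disjoint union of two copies of the power set of the natural numbers, the second one
preordered by inclusion up to finite sets. -/
def TwoCopiesStar : Type := Set ℕ ⊕ Set ℕ

instance twoCopiesStarInst : witnessLang.Structure TwoCopiesStar where
  funMap f _ := Empty.elim f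
  RelMap {n} r := match n, r with
    | _, WitnessRel.le => fun x =>
        Sum.LiftRel (· ⊆ ·) (fun X Y : Set ℕ => (X \ Y).Finite) (x 0) (x 1)
    | _, WitnessRel.U => fun x => ∃ X : Set ℕ, x 0 = Sum.inl X
    | _, WitnessRel.R => fun x =>
        ∃ X Y : Set ℕ, (symmDiff X Y).Finite ∧ x 0 = Sum.inl X ∧ x 1 = Sum.inr Y

/-- The kernel of the projection onto the quotient, as a relation on infinite strings. -/
def wordSetoid : Setoid (Set.univ : Set (ℕ → Bool)) := Setoid.ker (collapse ∘ decode)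

theorem wordSetoid_iff {a b : (Set.univ : Set (ℕ → Bool))} :
    wordSetoid a b ↔ Sum.LiftRel (· = ·) eqStar (decode a) (decode b) :=
  collapse_eq_iff

theorem mem_pairSet_univ_iff {X : Type} {E : ↥(Set.univ : Set X) → ↥(Set.univ : Set X) → Prop}
    {x : Fin 2 → X} : x ∈ pairSet Set.univ E ↔ E ⟨x 0, trivial⟩ ⟨x 1, trivial⟩ := by
  constructor
  · rintro ⟨a, b, h, rfl⟩
    exact h
  · intro h
    exact ⟨_, _, h, by ext i; fin_cases i <;> rfl⟩

theorem isBuchiRecognizableRel_wordSetoid :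
    IsBuchiRecognizableRel (pairSet Set.univ fun a b => wordSetoid a b) := by
  refine isBuchiRecognizableRel_of_iff (fun b => b 0 = true ∧ b 1 = true) (fun b => b 0 = b 1)
    (fun b => b 0 = false ∧ b 1 = false) (fun b => b 0 = b 1) fun x => ?_
  rw [mem_pairSet_univ_iff, wordSetoid_iff, liftRel_decode_iff, wordSet_eq_iff]
  exact or_congr_right (and_congr_right fun _ => wordSet_symmDiff_finite_iff)

theorem isBuchiRecognizable_univ {α : Type} : IsBuchiRecognizable (Set.univ : Set (ℕ → α)) := by
  convert isBuchiRecognizable_safety_or_eventually (β := α) (fun _ => True) (fun _ => True)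
    (fun _ => True) (fun _ => True) using 1
  simp

theorem isBuchiRecognizableRel_first {R : Set (Fin 1 → ℕ → Bool)}
    (h : ∀ x, x ∈ R ↔ x 0 0 = true) : IsBuchiRecognizableRel R := by
  refine isBuchiRecognizableRel_of_iff (fun b => b 0 = true) (fun _ => True)
    (fun _ => False) (fun _ => False) fun x => ?_
  simp [h]

/-- `decode` as an equivalence. -/
noncomputable def decodeEquiv : (Set.univ : Set (ℕ → Bool)) ≃ Set ℕ ⊕ Set ℕ :=
  Equiv.ofBijective decode decode_bijective

/-- The structure of two copies of the power set, carried over to infinite strings. -/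
@[reducible]
noncomputable def wordStructure : witnessLang.Structure (Set.univ : Set (ℕ → Bool)) :=
  Equiv.inducedStructure (M := TwoCopies) decodeEquiv.symm

/-- The structure of two copies of the power set with the second one ordered modulo finite sets,
carried over to infinite strings. -/
@[reducible]
noncomputable def wordStructureStar : witnessLang.Structure (Set.univ : Set (ℕ → Bool)) :=
  Equiv.inducedStructure (M := TwoCopiesStar) decodeEquiv.symm

theorem isBuchiAutomatic_wordStructure :
    @IsBuchiAutomatic witnessLang _ Bool Set.univ wordStructure := by
  let := wordStructure
  refine ⟨Set.univ_nonempty, isBuchiRecognizable_univ, ?_⟩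
  rintro n (_ | _ | _)
  -- Both copies carry plain inclusion, so the selectors need only agree.
  · refine isBuchiRecognizableRel_of_iff (fun b => b 0 = b 1) (fun b => b 0 = true → b 1 = true)
      (fun _ => False) (fun _ => False) fun x => ?_
    refine mem_relSet_univ_iff.trans (liftRel_decode_iff.trans ?_)
    rw [← or_and_right, wordSet_subset_iff, false_and, or_false]
    refine and_congr_left fun _ => ?_
    have key : ∀ b b' : Bool, (b = true ∧ b' = true) ∨ (b = false ∧ b' = false) ↔ b = b' := by
      decide
    exact key _ _
  · exact isBuchiRecognizableRel_first fun x =>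
      mem_relSet_univ_iff.trans exists_decode_eq_inl_iff
  · refine isBuchiRecognizableRel_of_iff (fun b => b 0 = true ∧ b 1 = false) (fun b => b 0 = b 1)
      (fun _ => False) (fun _ => False) fun x => ?_
    refine mem_relSet_univ_iff.trans (Iff.trans ?_
      ((exists_decode_eq_inl_inr_iff (A := (· = ·)) (w := ⟨x 0, trivial⟩)
        (v := ⟨x 1, trivial⟩)).trans ?_))
    · exact ⟨fun ⟨X, h⟩ => ⟨X, X, rfl, h⟩, fun ⟨X, Y, hXY, h⟩ => ⟨X, by subst hXY; exact h⟩⟩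
    · rw [wordSet_eq_iff, false_and, or_false]

theorem isBuchiAutomatic_wordStructureStar :
    @IsBuchiAutomatic witnessLang _ Bool Set.univ wordStructureStar := by
  let := wordStructureStar
  refine ⟨Set.univ_nonempty, isBuchiRecognizable_univ, ?_⟩
  rintro n (_ | _ | _)
  · refine isBuchiRecognizableRel_of_iff (fun b => b 0 = true ∧ b 1 = true)
      (fun b => b 0 = true → b 1 = true) (fun b => b 0 = false ∧ b 1 = false)
      (fun b => b 0 = true → b 1 = true) fun x => ?_
    refine mem_relSet_univ_iff.trans (liftRel_decode_iff.trans ?_)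
    rw [wordSet_subset_iff]
    exact or_congr_right (and_congr_right fun _ => wordSet_diff_finite_iff)
  · exact isBuchiRecognizableRel_first fun x =>
      mem_relSet_univ_iff.trans exists_decode_eq_inl_iff
  · refine isBuchiRecognizableRel_of_iff (fun _ => False) (fun _ => False)
      (fun b => b 0 = true ∧ b 1 = false) (fun b => b 0 = b 1) fun x => ?_
    refine mem_relSet_univ_iff.trans (exists_decode_eq_inl_inr_iff.trans ?_)
    rw [false_and, false_or]
    exact and_congr_right fun _ => wordSet_symmDiff_finite_iff

/-! ### Identification of the quotients -/

theorem leStar_iff_exists {a b : Quotient eqStar} : leStar a b ↔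
    ∃ X Y : Set ℕ, Quotient.mk eqStar X = a ∧ Quotient.mk eqStar Y = b ∧ X ⊆ Y := by
  constructor
  · obtain ⟨X, rfl⟩ := Quotient.mk_surjective a
    obtain ⟨Y, rfl⟩ := Quotient.mk_surjective b
    intro h
    -- Removing the finite set `X \ Y` from `X` keeps its class and makes the inclusion exact.
    refine ⟨X ∩ Y, Y, Quotient.sound ?_, rfl, Set.inter_subset_right⟩
    refine Set.Finite.subset h fun n hn => ?_
    simp only [Set.mem_symmDiff, Set.mem_inter_iff, Set.mem_sdiff] at hn ⊢
    tauto
  · rintro ⟨X, Y, rfl, rfl, h⟩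
    change (X \ Y).Finite
    simp [Set.sdiff_eq_empty.2 h]

theorem relMap_iff_exists_twoCopies {n : ℕ} (r : witnessLang.Relations n)
    (x : Fin n → PowersetAndQuotient) : Language.Structure.RelMap r x ↔
      ∃ y : Fin n → TwoCopies, (∀ i, collapse (y i) = x i) ∧ Language.Structure.RelMap r y := by
  rcases r with _ | _ | _
  · change Sum.LiftRel _ _ (x 0) (x 1) ↔ ∃ y : Fin 2 → TwoCopies, _ ∧ Sum.LiftRel _ _ (y 0) (y 1)
    constructor
    · generalize hu : x 0 = u
      generalize hv : x 1 = v
      rintro (⟨h⟩ | ⟨h⟩)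
      · rename_i X Y
        refine ⟨![Sum.inl X, Sum.inl Y], ?_, Sum.LiftRel.inl h⟩
        rw [Fin.forall_fin_two, hu, hv]
        exact ⟨rfl, rfl⟩
      · obtain ⟨X, Y, rfl, rfl, hXY⟩ := leStar_iff_exists.1 h
        refine ⟨![Sum.inr X, Sum.inr Y], ?_, Sum.LiftRel.inr hXY⟩
        rw [Fin.forall_fin_two, hu, hv]
        exact ⟨rfl, rfl⟩
    · rintro ⟨y, hy, h⟩
      rw [← hy 0, ← hy 1]
      revert h
      generalize y 0 = u
      generalize y 1 = v
      rintro (⟨h⟩ | ⟨h⟩)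
      · exact Sum.LiftRel.inl h
      · exact Sum.LiftRel.inr (leStar_iff_exists.2 ⟨_, _, rfl, rfl, h⟩)
  · constructor
    · rintro ⟨X, hX⟩
      refine ⟨![Sum.inl X], ?_, X, rfl⟩
      rw [Fin.forall_fin_one, hX]
      rfl
    · rintro ⟨y, hy, X, hX⟩
      exact ⟨X, by rw [← hy 0, hX]; rfl⟩
  · constructor
    · rintro ⟨X, h0, h1⟩
      refine ⟨![Sum.inl X, Sum.inr X], ?_, X, rfl, rfl⟩
      rw [Fin.forall_fin_two, h0, h1]
      exact ⟨rfl, rfl⟩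
    · rintro ⟨y, hy, X, h0, h1⟩
      exact ⟨X, by rw [← hy 0, h0]; rfl, by rw [← hy 1, h1]; rfl⟩

/-- `TwoCopiesStar` is the pullback of the target along `collapse`, which is why its `R` relates
sets up to finite differences. Its relations thus depend only on classes, which gives both the
congruence and the quotient. -/
theorem relMap_collapse_iff {n : ℕ} (r : witnessLang.Relations n) (y : Fin n → TwoCopiesStar) :
    Language.Structure.RelMap r (fun i => collapse (y i)) ↔ Language.Structure.RelMap r y := by
  rcases r with _ | _ | _
  · change Sum.LiftRel _ _ (collapse (y 0)) (collapse (y 1)) ↔ Sum.LiftRel _ _ (y 0) (y 1)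
    rcases y 0 with X | X <;> rcases y 1 with Y | Y
    · exact Sum.liftRel_inl_inl.trans Sum.liftRel_inl_inl.symm
    · exact iff_of_false Sum.not_liftRel_inl_inr Sum.not_liftRel_inl_inr
    · exact iff_of_false Sum.not_liftRel_inr_inl Sum.not_liftRel_inr_inl
    · refine Sum.liftRel_inr_inr.trans (Iff.trans ?_ Sum.liftRel_inr_inr.symm)
      exact Iff.rfl
  · change (∃ X, collapse (y 0) = Sum.inl X) ↔ ∃ X, y 0 = Sum.inl X
    rcases y 0 with X | X
    · exact iff_of_true ⟨X, rfl⟩ ⟨X, rfl⟩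
    · exact iff_of_false (fun ⟨_, h⟩ => Sum.inr_ne_inl h) (fun ⟨_, h⟩ => Sum.inr_ne_inl h)
  · change (∃ X, collapse (y 0) = Sum.inl X ∧ collapse (y 1) = Sum.inr (Quotient.mk eqStar X)) ↔
      ∃ X Y, (symmDiff X Y).Finite ∧ y 0 = Sum.inl X ∧ y 1 = Sum.inr Y
    constructor
    · rintro ⟨X, h0, h1⟩
      rcases hy0 : y 0 with X' | X' <;> rcases hy1 : y 1 with Y | Y <;> rw [hy0] at h0 <;>
        rw [hy1] at h1
      · exact (Sum.inl_ne_inr h1).elim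
      · obtain rfl : X' = X := Sum.inl_injective h0
        exact ⟨X', Y, eqStar.symm (Quotient.exact (Sum.inr_injective h1)), rfl, rfl⟩
      · exact (Sum.inr_ne_inl h0).elim
      · exact (Sum.inr_ne_inl h0).elim
    · rintro ⟨X, Y, h, h0, h1⟩
      rw [h0, h1]
      exact ⟨X, rfl, congrArg Sum.inr (Quotient.sound (eqStar.symm h))⟩

theorem not_presentable_of_equiv {M : Type} [witnessLang.Structure M]
    (h : Nonempty (M ≃[witnessLang] PowersetAndQuotient)) :
    ¬ IsBuchiPresentable witnessLang M ∧ ¬ IsBorelPresentable witnessLang M := by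
  obtain ⟨e⟩ := h
  have : ¬ IsBorelPresentable witnessLang M := fun hM =>
    not_isBorelPresentable_powersetAndQuotient (hM.congr e)
  exact ⟨fun hM => this hM.isBorelPresentable, this⟩

theorem collapse_decode_surjective : Function.Surjective (collapse ∘ decode) :=
  collapse_surjective.comp decode_bijective.surjective

theorem nonempty_quotient_wordStructure_equiv :
    letI := wordStructure
    Nonempty (QuotientStructure witnessLang wordSetoid ≃[witnessLang] PowersetAndQuotient) := by
  let := wordStructure
  refine nonempty_quotient_equiv _ collapse_decode_surjective (fun _ _ => Iff.rfl) fun r x => ?_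
  rw [relMap_iff_exists_twoCopies]
  constructor
  · rintro ⟨y, hy, h⟩
    obtain ⟨z, rfl⟩ : ∃ z, y = decodeEquiv ∘ z := ⟨decodeEquiv.symm ∘ y, by
      ext i : 1
      exact (decodeEquiv.apply_symm_apply _).symm⟩
    exact ⟨z, hy, h⟩
  · rintro ⟨z, hz, h⟩
    exact ⟨decodeEquiv ∘ z, hz, h⟩

theorem relMap_wordStructureStar_iff {n : ℕ} (r : witnessLang.Relations n)
    (y : Fin n → (Set.univ : Set (ℕ → Bool))) :
    wordStructureStar.RelMap r y ↔
      Language.Structure.RelMap r (fun i => collapse (decode (y i))) :=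
  (relMap_collapse_iff r _).symm

theorem nonempty_quotient_wordStructureStar_equiv :
    letI := wordStructureStar
    Nonempty (QuotientStructure witnessLang wordSetoid ≃[witnessLang] PowersetAndQuotient) := by
  let := wordStructureStar
  refine nonempty_quotient_equiv _ collapse_decode_surjective (fun _ _ => Iff.rfl) fun r x => ?_
  constructor
  · intro h
    choose y hy using fun i => collapse_decode_surjective (x i)
    obtain rfl : (fun i => collapse (decode (y i))) = x := funext hy
    exact ⟨y, fun _ => rfl, (relMap_wordStructureStar_iff r y).2 h⟩
  · rintro ⟨y, hy, h⟩
    obtain rfl : (fun i => collapse (decode (y i))) = x := funext hy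
    exact (relMap_wordStructureStar_iff r y).1 h

theorem isCongruence_wordSetoid :
    letI := wordStructureStar
    IsCongruence witnessLang wordSetoid := by
  let := wordStructureStar
  intro n r x y h
  have hxy : (fun i => collapse (decode (x i))) = fun i => collapse (decode (y i)) := funext h
  exact (relMap_wordStructureStar_iff r x).trans
    ((iff_of_eq (by rw [hxy])).trans (relMap_wordStructureStar_iff r y).symm)

theorem exists_wordStructure_equiv :
    letI := wordStructure
    ∃ e : (Set.univ : Set (ℕ → Bool)) ≃[witnessLang] TwoCopies,
      ∀ a b, wordSetoid a b ↔ twoCopiesRel (e a) (e b) :=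
  letI := wordStructure
  ⟨(Equiv.inducedStructureEquiv (M := TwoCopies) decodeEquiv.symm).symm,
    fun _ _ => wordSetoid_iff⟩

theorem mainTheorem6 :
    -- two copies of the power set, with `=^*` on the second copy
    (∃ (α : Type) (_ : Finite α) (D : Set (ℕ → α)) (_ : witnessLang.Structure D) (E : Setoid D),
      IsBuchiAutomatic witnessLang D ∧
      IsBuchiRecognizableRel (pairSet D (fun a b => E a b)) ∧
      (∃ e : D ≃[witnessLang] TwoCopies, ∀ a b : D, E a b ↔ twoCopiesRel (e a) (e b)) ∧
      Nonempty (QuotientStructure witnessLang E ≃[witnessLang] PowersetAndQuotient) ∧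
      ¬ IsBuchiPresentable witnessLang (QuotientStructure witnessLang E) ∧
      ¬ IsBorelPresentable witnessLang (QuotientStructure witnessLang E)) ∧
    -- the same quotient, by an equivalence relation that respects all basic relations
    (∃ (α : Type) (_ : Finite α) (D : Set (ℕ → α)) (_ : witnessLang.Structure D) (E : Setoid D),
      IsBuchiAutomatic witnessLang D ∧
      IsBuchiRecognizableRel (pairSet D (fun a b => E a b)) ∧
      IsCongruence witnessLang E ∧
      Nonempty (QuotientStructure witnessLang E ≃[witnessLang] PowersetAndQuotient) ∧
      ¬ IsBuchiPresentable witnessLang (QuotientStructure witnessLang E) ∧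
      ¬ IsBorelPresentable witnessLang (QuotientStructure witnessLang E)) := by

  refine ⟨⟨Bool, inferInstance, Set.univ, wordStructure, wordSetoid,
    isBuchiAutomatic_wordStructure, isBuchiRecognizableRel_wordSetoid, exists_wordStructure_equiv,
    nonempty_quotient_wordStructure_equiv, ?_⟩, ⟨Bool, inferInstance, Set.univ, wordStructureStar,
    wordSetoid, isBuchiAutomatic_wordStructureStar, isBuchiRecognizableRel_wordSetoid,
    isCongruence_wordSetoid, nonempty_quotient_wordStructureStar_equiv, ?_⟩⟩
  · let := wordStructure
    exact not_presentable_of_equiv nonempty_quotient_wordStructure_equiv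
  · let := wordStructureStar
    exact not_presentable_of_equiv nonempty_quotient_wordStructureStar_equiv
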